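/- Let $R$ be an associative ring with identity. For right $R$-modules $M,N$, call $M$ almost $N$-injective if for every submodule $N'\subseteq N$, with inclusion $\iota:N'\to N$, and every homomorphism $f:N'\to M$, either there is a homomorphism $g:N\to M$ with $f=g\iota$, or there are a nonzero idempotent $\pi\in\operatorname{End}_R(N)$ and a homomorphism $h:M\to\pi(N)$ with $hf=\pi\iota$. Call $M$ almost injective if it is almost $N$-injective for every right $R$-module $N$, and call $R$ a right almost $V$-ring if every simple right $R$-module is almost injective. A module is a $V$-module if each of its proper submodules is an intersection of maximal submodules, and a ring is a right $V$-ring if it is a $V$-module as a right module over itself. A module is local if it has a largest proper submodule, and $J(\cdot)$ denotes the Jacobson radical of a module or of a ring. Then the following assertions are equivalent: 1) $R$ is a right almost $V$-ring. 2) Every right $R$-module either is a $V$-module or contains a nonzero direct summand which is a projective module (both may happen). 3) There exists a (possibly empty or infinite) set of orthogonal idempotents $\{e_i\}_{i\in I}$ of $R$ such that a) $e_iR$ is a local injective right $R$-module of length two for every $i\in I$; b) $J(R)=\bigoplus_{i\in I}J(e_iR)$ as an internal direct sum of right ideals of $R$; c) $R/J(R)$ is a right $V$-ring. -/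

import Mathlib

universe u

/-!
Right modules over a ring `R` are `Module Rᵐᵒᵖ M`, with `m · r = MulOpposite.op r • m`. The module
notions below are stated for left modules over an arbitrary ring `A` and are used with `A = Rᵐᵒᵖ`.
-/

/-- `M` is almost `N`-injective: every homomorphism `f : N' → M` from a submodule `N'` of `N`
either extends to `N`, or there are a nonzero idempotent `π ∈ End(N)` and a homomorphism
`h : M → π(N)` such that `h ∘ f` is the restriction of `π` to `N'`. -/
def IsAlmostInjectiveRel (A M N : Type u) [Ring A] [AddCommGroup M] [Module A M]
    [AddCommGroup N] [Module A N] : Prop :=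
  ∀ (N' : Submodule A N) (f : N' →ₗ[A] M),
    (∃ g : N →ₗ[A] M, f = g ∘ₗ N'.subtype) ∨
    (∃ π : Module.End A N, IsIdempotentElem π ∧ π ≠ 0 ∧
      ∃ h : M →ₗ[A] LinearMap.range π, h ∘ₗ f = π.rangeRestrict ∘ₗ N'.subtype)

/-- `M` is almost injective: it is almost `N`-injective for every module `N`. -/
def IsAlmostInjective (A M : Type u) [Ring A] [AddCommGroup M] [Module A M] : Prop :=
  ∀ (N : Type u) [AddCommGroup N] [Module A N], IsAlmostInjectiveRel A M N

/-- `M` is a V-module (cosemisimple): every proper submodule of `M` is an intersection of maximal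
submodules of `M`. -/
def IsVModule (A M : Type u) [Ring A] [AddCommGroup M] [Module A M] : Prop :=
  ∀ N : Submodule A M, N ≠ ⊤ →
    ∃ S : Set (Submodule A M), (∀ K ∈ S, IsCoatom K) ∧ N = sInf S

/-- `M` is a local module: it has a largest proper submodule. -/
def IsLocalModule (A M : Type u) [Ring A] [AddCommGroup M] [Module A M] : Prop :=
  ∃ N : Submodule A M, N ≠ ⊤ ∧ ∀ K : Submodule A M, K ≠ ⊤ → K ≤ N

/-- `R` is a right V-ring: `R`, as a right module over itself, is a V-module. -/
def IsRightVRing (R : Type u) [Ring R] : Prop :=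
  IsVModule Rᵐᵒᵖ R

/-- `R` is a right almost V-ring: every simple right `R`-module is almost injective. -/
def IsRightAlmostVRing (R : Type u) [Ring R] : Prop :=
  ∀ (S : Type u) [AddCommGroup S] [Module Rᵐᵒᵖ S], IsSimpleModule Rᵐᵒᵖ S →
    IsAlmostInjective Rᵐᵒᵖ S

/-- The principal right ideal `eR`, as a submodule of the right module `R`. -/
def principalRightIdeal {R : Type u} [Ring R] (e : R) : Submodule Rᵐᵒᵖ R :=
  Submodule.span Rᵐᵒᵖ {e}

theorem mem_principalRightIdeal {R : Type u} [Ring R] {e x : R} :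
    x ∈ principalRightIdeal e ↔ ∃ r : R, x = e * r := by
  unfold principalRightIdeal
  rw [Submodule.mem_span_singleton]
  constructor
  · rintro ⟨a, rfl⟩
    exact ⟨a.unop, rfl⟩
  · rintro ⟨r, rfl⟩
    exact ⟨MulOpposite.op r, rfl⟩

/-- The Jacobson radical `J(P)` of a submodule `P` of `M` (the intersection of the maximal
submodules of `P`), regarded as a submodule of `M`. -/
def radicalOf {A M : Type u} [Ring A] [AddCommGroup M] [Module A M] (P : Submodule A M) :
    Submodule A M :=
  (Module.jacobson A P).map P.subtype

/-!
All three conditions say that every subdirectly irreducible right module that is not simple is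
projective. The link is Zorn's lemma: for `x ∉ K ≤ M`, a submodule `C ⊇ K` maximal with respect to
`x ∉ C` has the property that `M / C` is subdirectly irreducible, its monolith being generated by
the class of `x`. So either `C` is a maximal submodule, or `M / C` is projective and `C` has a
projective complement.

Applied to a quotient of an injective hull, this shows that a non-simple subdirectly irreducible
module is injective, and then local of length two: the maximal submodules containing its monolith
intersect in the monolith, while a uniform module that is both projective and injective is not the
sum of two proper submodules. A maximal independent family of such right ideals splits off
orthogonal idempotents `eᵢ`. Each `J(eᵢR)` is essential in `eᵢR`, so a right ideal of this kind
meeting `⨁ J(eᵢR)` trivially would contradict maximality; hence `J(R) = ⨁ J(eᵢR)`.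

Conversely, if `R / J(R)` is a right V-ring, a non-simple subdirectly irreducible `U` is not
annihilated by `J(R)`, hence not by some `J(eᵢR)`. This gives an embedding of `eᵢR` into `U`, which
is onto because `eᵢR` is injective.
-/

open LinearMap (ker range)

section Lattice

variable {α : Type*} [CompleteLattice α] [IsModularLattice α]

theorem disjoint_finset_sup_of_essential {ι : Type*} {p j : ι → α} (hj : iSupIndep j)
    (hess : ∀ i b, Disjoint (j i) b → Disjoint (p i) b) (s : Finset ι) {d : α}
    (hd : Disjoint d (s.sup j)) : Disjoint d (s.sup p) := by
  classical
  induction s using Finset.induction_on generalizing d with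
  | empty => simp
  | insert k s hk ih =>
    rw [Finset.sup_insert] at hd ⊢
    have hks : Disjoint (j k) (s.sup j) := (hj k).mono_right <| Finset.sup_le fun i hi =>
      le_iSup₂_of_le i (ne_of_mem_of_not_mem hi hk) le_rfl
    have hsup : Disjoint (d ⊔ j k) (s.sup p) :=
      ih (Disjoint.disjoint_sup_left_of_disjoint_sup_right hks hd)
    have hk' : Disjoint (p k) (d ⊔ s.sup p) :=
      hess k _ <| Disjoint.disjoint_sup_right_of_disjoint_sup_left
        (hd.mono_right le_sup_left).symm (by rwa [sup_comm])
    rw [sup_comm]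
    exact Disjoint.disjoint_sup_right_of_disjoint_sup_left (hsup.mono_left le_sup_left) hk'.symm

theorem disjoint_iSup_of_essential [IsCompactlyGenerated α] {ι : Type*} {p j : ι → α}
    (hj : iSupIndep j) (hess : ∀ i b, Disjoint (j i) b → Disjoint (p i) b) {d : α}
    (hd : Disjoint d (⨆ i, j i)) : Disjoint d (⨆ i, p i) := by
  classical
  have hdir : Directed (· ≤ ·) fun s : Finset ι => ⨆ i ∈ s, p i :=
    Monotone.directed_le fun s t hst => biSup_mono hst
  rw [iSup_eq_iSup_finset, hdir.disjoint_iSup_right]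
  intro s
  rw [← Finset.sup_eq_iSup]
  exact disjoint_finset_sup_of_essential hj hess s
    (hd.mono_right (Finset.sup_le fun i _ => le_iSup j i))

theorem sSupIndep_insert_of_disjoint {s : Set α} (hs : sSupIndep s) {d : α}
    (hd : Disjoint d (sSup s)) : sSupIndep (insert d s) := by
  rintro x (rfl | hxs)
  · exact hd.mono_right (sSup_le_sSup fun y hy => hy.1.resolve_left hy.2)
  · have hxd : Disjoint (x ⊔ sSup (s \ {x})) d :=
      (hd.mono_right (sup_le (le_sSup hxs) (sSup_le_sSup Set.sdiff_subset))).symm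
    refine (Disjoint.disjoint_sup_right_of_disjoint_sup_left (hs hxs) hxd).mono_right
      (sSup_le ?_)
    rintro y ⟨rfl | hy, hyx⟩
    · exact le_sup_right
    · exact (le_sSup (show y ∈ s \ {x} from ⟨hy, hyx⟩)).trans le_sup_left

theorem exists_maximal_sSupIndep [IsCompactlyGenerated α] (p : α → Prop) :
    ∃ s : Set α, sSupIndep s ∧ (∀ a ∈ s, p a) ∧ ∀ a ≠ ⊥, p a → ¬ Disjoint a (sSup s) := by
  obtain ⟨s, hs⟩ := zorn_subset {s : Set α | sSupIndep s ∧ ∀ a ∈ s, p a} fun c hc hchain =>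
    ⟨⋃₀ c, ⟨iSupIndep_sUnion_of_directed hchain.directedOn fun t ht => (hc ht).1,
      fun a ⟨t, ht, hat⟩ => (hc ht).2 a hat⟩, fun t ht => Set.subset_sUnion_of_mem ht⟩
  refine ⟨s, hs.prop.1, hs.prop.2, fun a ha hpa hdisj => ha ?_⟩
  have hinsert : insert a s ⊆ s := hs.le_of_ge
    ⟨sSupIndep_insert_of_disjoint hs.prop.1 hdisj, Set.forall_mem_insert.2 ⟨hpa, hs.prop.2⟩⟩
    (Set.subset_insert a s)
  exact hdisj.eq_bot_of_le (le_sSup (hinsert (Set.mem_insert a s)))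

end Lattice

section Splitting

variable {A : Type*} [Ring A] {M N P : Type*} [AddCommGroup M] [Module A M] [AddCommGroup N]
  [Module A N] [AddCommGroup P] [Module A P]

theorem map_ne_bot_of_injective {f : M →ₗ[A] N} (hf : Function.Injective f)
    {K : Submodule A M} (hK : K ≠ ⊥) : K.map f ≠ ⊥ := fun h =>
  hK (Submodule.map_injective_of_injective hf (h.trans (Submodule.map_bot f).symm))

theorem range_ne_bot_of_injective [Nontrivial M] {f : M →ₗ[A] N} (hf : Function.Injective f) :
    range f ≠ ⊥ := by
  rw [LinearMap.range_eq_map]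
  exact map_ne_bot_of_injective hf top_ne_bot

theorem isCompl_range_ker_of_comp_eq_id {g : P →ₗ[A] M} {r : M →ₗ[A] P}
    (h : r ∘ₗ g = LinearMap.id) : IsCompl (range g) (ker r) := by
  have hrg : ∀ y, r (g y) = y := LinearMap.congr_fun h
  have hidem : IsIdempotentElem (g ∘ₗ r) := LinearMap.ext fun x => congrArg g (hrg (r x))
  have hrange : range (g ∘ₗ r) = range g :=
    LinearMap.range_comp_of_range_eq_top g (LinearMap.range_eq_top.2 fun y => ⟨g y, hrg y⟩)
  have hker : ker (g ∘ₗ r) = ker r :=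
    LinearMap.ker_comp_of_ker_eq_bot r
      (LinearMap.ker_eq_bot.2 (Function.LeftInverse.injective hrg))
  simpa only [hrange, hker] using LinearMap.IsIdempotentElem.isCompl hidem

theorem exists_comp_eq_of_ker_le {φ : M →ₗ[A] N} (hφ : Function.Surjective φ) {g : M →ₗ[A] P}
    (h : ker φ ≤ ker g) : ∃ ψ : N →ₗ[A] P, ψ ∘ₗ φ = g := by
  refine ⟨(ker φ).liftQ g h ∘ₗ (φ.quotKerEquivOfSurjective hφ).symm, LinearMap.ext fun x => ?_⟩
  have hx : (φ.quotKerEquivOfSurjective hφ).symm (φ x) = (ker φ).mkQ x :=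
    (LinearEquiv.symm_apply_eq _).2 rfl
  rw [LinearMap.comp_apply, LinearMap.comp_apply, LinearEquiv.coe_coe, hx]
  rfl

theorem exists_isCompl_of_projective_quotient (C : Submodule A M)
    [Module.Projective A (M ⧸ C)] : ∃ D, IsCompl D C ∧ Module.Projective A D := by
  obtain ⟨s, hs⟩ := C.mkQ.exists_rightInverse_of_surjective C.range_mkQ
  have hD : IsCompl (range s) C := by
    simpa only [Submodule.ker_mkQ] using isCompl_range_ker_of_comp_eq_id hs
  exact ⟨range s, hD, .of_equiv (C.quotientEquivOfIsCompl _ hD.symm)⟩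

theorem projective_range_of_isIdempotentElem [Module.Projective A M] {π : Module.End A M}
    (hπ : IsIdempotentElem π) : Module.Projective A (range π) :=
  .of_split (range π).subtype π.rangeRestrict <| LinearMap.ext fun x =>
    Subtype.ext ((LinearMap.IsIdempotentElem.isProj_range π hπ).map_id x x.2)

end Splitting

section Injective

variable {A M P Q : Type u} [Ring A] [AddCommGroup M] [Module A M] [AddCommGroup P] [Module A P]
  [AddCommGroup Q] [Module A Q]

theorem injective_of_retract [Module.Injective A Q] {i : P →ₗ[A] Q} {r : Q →ₗ[A] P}
    (h : r ∘ₗ i = LinearMap.id) : Module.Injective A P where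
  out X Y _ _ _ _ f hf g := by
    obtain ⟨k, hk⟩ := Module.Injective.out f hf (i ∘ₗ g)
    refine ⟨r ∘ₗ k, fun x => ?_⟩
    rw [LinearMap.comp_apply, hk]
    exact LinearMap.congr_fun h (g x)

theorem injective_of_linearEquiv [Module.Injective A Q] (e : Q ≃ₗ[A] P) : Module.Injective A P :=
  injective_of_retract e.comp_symm

theorem exists_injective_embedding (A M : Type u) [Ring A] [AddCommGroup M] [Module A M] :
    ∃ (Q : Type u) (_ : AddCommGroup Q) (_ : Module A Q) (i : M →ₗ[A] Q),
      Module.Injective A Q ∧ Function.Injective i := by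
  let p := (CategoryTheory.EnoughInjectives.presentation (ModuleCat.of A M)).some
  have h : CategoryTheory.Injective (ModuleCat.of A p.J) := p.injective
  exact ⟨p.J, inferInstance, inferInstance, p.f.hom,
    Module.injective_module_of_injective_object A p.J, (ModuleCat.mono_iff_injective p.f).1 p.mono⟩

theorem exists_retraction_of_disjoint {D B : Submodule A M} [Module.Injective A D]
    (h : Disjoint D B) : ∃ q : M →ₗ[A] D, (∀ x : D, q x = x) ∧ B ≤ ker q := by
  have hinj : Function.Injective (B.mkQ ∘ₗ D.subtype) := by
    rw [← LinearMap.ker_eq_bot, LinearMap.ker_comp, Submodule.ker_mkQ]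
    exact Submodule.disjoint_iff_comap_eq_bot.1 h
  obtain ⟨k, hk⟩ := Module.Injective.out _ hinj LinearMap.id
  refine ⟨k ∘ₗ B.mkQ, hk, ?_⟩
  simpa only [Submodule.ker_mkQ] using LinearMap.ker_le_ker_comp B.mkQ k

end Injective

section Monolith

/-- `S` is the monolith of `M`: the smallest nonzero submodule. -/
structure IsMonolith {A M : Type*} [Ring A] [AddCommGroup M] [Module A M] (S : Submodule A M) :
    Prop where
  ne_bot : S ≠ ⊥
  le_of_ne_bot {N : Submodule A M} : N ≠ ⊥ → S ≤ N

/-- `M` is subdirectly irreducible but not simple: it has a monolith, which is proper. -/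
def HasProperMonolith (A M : Type*) [Ring A] [AddCommGroup M] [Module A M] : Prop :=
  ∃ S : Submodule A M, IsMonolith S ∧ S ≠ ⊤

variable {A M N : Type*} [Ring A] [AddCommGroup M] [Module A M] [AddCommGroup N] [Module A N]
  {S : Submodule A M}

namespace IsMonolith

theorem isAtom (hS : IsMonolith S) : IsAtom S :=
  ⟨hS.ne_bot, fun _ hN => not_not.1 fun h => hN.not_ge (hS.le_of_ne_bot h)⟩

theorem isSimpleModule (hS : IsMonolith S) : IsSimpleModule A S :=
  isSimpleModule_iff_isAtom.2 hS.isAtom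

theorem eq_top_of_isSimpleModule (hS : IsMonolith S) [IsSimpleModule A M] : S = ⊤ :=
  (eq_bot_or_eq_top S).resolve_left hS.ne_bot

theorem isSimpleModule_of_eq_top (hS : IsMonolith S) (h : S = ⊤) : IsSimpleModule A M :=
  have := hS.isSimpleModule
  .congr ((Submodule.topEquiv (R := A) (M := M)).symm.trans (LinearEquiv.ofEq _ _ h.symm))

theorem eq_bot_of_disjoint (hS : IsMonolith S) {K L : Submodule A M} (h : Disjoint K L)
    (hK : K ≠ ⊥) : L = ⊥ :=
  not_not.1 fun hL => hS.ne_bot (le_bot_iff.1 (h (hS.le_of_ne_bot hK) (hS.le_of_ne_bot hL)))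

theorem map_equiv (hS : IsMonolith S) (e : M ≃ₗ[A] N) :
    IsMonolith (S.map (e : M →ₗ[A] N)) where
  ne_bot := map_ne_bot_of_injective e.injective hS.ne_bot
  le_of_ne_bot {K} hK := by
    refine Submodule.map_le_iff_le_comap.2 (hS.le_of_ne_bot fun h => hK ?_)
    rw [← Submodule.map_comap_eq_of_surjective (f := (e : M →ₗ[A] N)) e.surjective K, h,
      Submodule.map_bot]

theorem submoduleOf (hS : IsMonolith S) {K : Submodule A M} (hK : K ≠ ⊥) :
    IsMonolith (S.submoduleOf K) where
  ne_bot h := hS.ne_bot <|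
    (Submodule.disjoint_iff_comap_eq_bot.2 h).eq_bot_of_ge (hS.le_of_ne_bot hK)
  le_of_ne_bot {L} hL x hx := by
    obtain ⟨y, hy, hyx⟩ := hS.le_of_ne_bot (map_ne_bot_of_injective K.injective_subtype hL) hx
    rwa [← K.injective_subtype hyx]

theorem bijective_of_comp_eq_id (hS : IsMonolith S) [Nontrivial N] {g : N →ₗ[A] M}
    {r : M →ₗ[A] N} (h : r ∘ₗ g = LinearMap.id) : Function.Bijective r := by
  have hrg : Function.LeftInverse r g := LinearMap.congr_fun h
  have hker : ker r = ⊥ := hS.eq_bot_of_disjoint (isCompl_range_ker_of_comp_eq_id h).disjoint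
    (range_ne_bot_of_injective hrg.injective)
  exact ⟨LinearMap.ker_eq_bot.1 hker, hrg.surjective⟩

theorem projective_of_isCompl (hS : IsMonolith S) {K L : Submodule A M} (hK : K ≠ ⊥)
    (h : IsCompl K L) [Module.Projective A K] : Module.Projective A M := by
  have hL : L = ⊥ := hS.eq_bot_of_disjoint h.disjoint hK
  have hKtop : K = ⊤ := by simpa only [hL, sup_bot_eq] using h.sup_eq_top
  exact .of_equiv ((LinearEquiv.ofEq _ _ hKtop).trans Submodule.topEquiv)

end IsMonolith

theorem HasProperMonolith.nontrivial (h : HasProperMonolith A M) : Nontrivial M :=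
  have ⟨_, hS, _⟩ := h
  (Submodule.nontrivial_iff A).1 ⟨_, _, hS.ne_bot⟩

theorem HasProperMonolith.congr (e : M ≃ₗ[A] N) (h : HasProperMonolith A M) :
    HasProperMonolith A N := by
  obtain ⟨S, hS, hStop⟩ := h
  refine ⟨_, hS.map_equiv e, fun htop => hStop ?_⟩
  exact Submodule.map_injective_of_injective e.injective (htop.trans (by simp))

theorem exists_maximal_notMem {K : Submodule A M} {x : M} (hx : x ∉ K) :
    ∃ C, K ≤ C ∧ Maximal (x ∉ ·) C :=
  zorn_le_nonempty₀ {C : Submodule A M | x ∉ C} (fun c hc hchain y hy => by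
    refine ⟨sSup c, fun hxc => ?_, fun z hz => le_sSup hz⟩
    obtain ⟨D, hD, hxD⟩ := (Submodule.mem_sSup_of_directed ⟨y, hy⟩ hchain.directedOn).1 hxc
    exact hc hD hxD) K hx

theorem isMonolith_span_mkQ {C : Submodule A M} {x : M} (hC : Maximal (x ∉ ·) C) :
    IsMonolith (Submodule.span A {C.mkQ x}) where
  ne_bot h := hC.prop (by simpa using h)
  le_of_ne_bot {K} hK := by
    rw [Submodule.span_singleton_le_iff_mem, ← Submodule.mem_comap]
    by_contra hx
    refine hK (Submodule.comap_injective_of_surjective C.mkQ_surjective ?_)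
    exact (hC.eq_of_le hx (Submodule.le_comap_mkQ C K)).symm.trans (by simp)

theorem exists_isCoatom_or_hasProperMonolith {K : Submodule A M} {x : M} (hx : x ∉ K) :
    ∃ C, K ≤ C ∧ x ∉ C ∧ (IsCoatom C ∨ HasProperMonolith A (M ⧸ C)) := by
  obtain ⟨C, hKC, hC⟩ := exists_maximal_notMem hx
  have hmono := isMonolith_span_mkQ hC
  refine ⟨C, hKC, hC.prop, or_iff_not_imp_right.2 fun h => ?_⟩
  have htop := not_not.1 fun htop => h ⟨_, hmono, htop⟩
  exact isSimpleModule_iff_isCoatom.1 (hmono.isSimpleModule_of_eq_top htop)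

end Monolith

section VModule

variable {A M : Type u} [Ring A] [AddCommGroup M] [Module A M]

theorem isVModule_iff :
    IsVModule A M ↔ ∀ (K : Submodule A M), ∀ x ∉ K, ∃ C, IsCoatom C ∧ K ≤ C ∧ x ∉ C := by
  constructor
  · intro h K x hx
    obtain ⟨S, hS, rfl⟩ := h K (by rintro rfl; exact hx trivial)
    simp only [Submodule.mem_sInf, not_forall] at hx
    obtain ⟨C, hC, hxC⟩ := hx
    exact ⟨C, hS C hC, sInf_le hC, hxC⟩
  · intro h K _
    refine ⟨{C | IsCoatom C ∧ K ≤ C}, fun C hC => hC.1,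
      le_antisymm (le_sInf fun C hC => hC.2) fun x hx => ?_⟩
    by_contra hxK
    obtain ⟨C, hC, hKC, hxC⟩ := h K x hxK
    exact hxC (Submodule.mem_sInf.1 hx C ⟨hC, hKC⟩)

theorem isVModule_iff_of_surjective {B N : Type u} [Ring B] [AddCommGroup N] [Module B N]
    {τ : A →+* B} [RingHomSurjective τ] {f : M →ₛₗ[τ] N} (hf : Function.Surjective f) :
    IsVModule B N ↔ ∀ K : Submodule A M, ker f ≤ K → ∀ x ∉ K,
      ∃ C, IsCoatom C ∧ K ≤ C ∧ x ∉ C := by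
  rw [isVModule_iff]
  constructor
  · intro h K hK x hx
    obtain ⟨C, hC, hKC, hxC⟩ := h (K.map f) (f x) (by
      rwa [← Submodule.mem_comap, Submodule.comap_map_eq_self hK])
    exact ⟨C.comap f, (Submodule.isCoatom_comap_iff hf).2 hC,
      Submodule.map_le_iff_le_comap.1 hKC, hxC⟩
  · intro h K y hy
    obtain ⟨x, rfl⟩ := hf y
    obtain ⟨C, hC, hKC, hxC⟩ := h (K.comap f) (LinearMap.ker_le_comap f) x hy
    have hker : ker f ≤ C := (LinearMap.ker_le_comap f).trans hKC
    refine ⟨C.map f, Submodule.isCoatom_map_of_ker_le hf hker hC, ?_, ?_⟩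
    · rw [← Submodule.map_comap_eq_of_surjective hf K]
      exact Submodule.map_mono hKC
    · rwa [← Submodule.mem_comap, Submodule.comap_map_eq_self hker]

theorem HasProperMonolith.not_isVModule (h : HasProperMonolith A M) : ¬ IsVModule A M := by
  obtain ⟨S, hS, hStop⟩ := h
  rw [isVModule_iff]
  intro hV
  obtain ⟨x, hx, hx0⟩ := Submodule.exists_mem_ne_zero_of_ne_bot hS.ne_bot
  obtain ⟨C, hC, -, hxC⟩ := hV ⊥ x (by simpa using hx0)
  have hCbot : C = ⊥ := not_not.1 fun hC0 => hxC (hS.le_of_ne_bot hC0 hx)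
  exact hStop (hC.2 S (hCbot ▸ hS.ne_bot.bot_lt))

end VModule

section AlmostInjective

/-- Every subdirectly irreducible `A`-module that is not simple is projective. All three conditions
of the theorem are compared with this one, for `A = Rᵐᵒᵖ`. -/
def IsMonolithicProjective (A : Type u) [Ring A] : Prop :=
  ∀ (U : Type u) [AddCommGroup U] [Module A U], HasProperMonolith A U → Module.Projective A U

variable {A : Type u} [Ring A]

section

variable {F U M P : Type*} [AddCommGroup F] [Module A F] [AddCommGroup U] [Module A U]
  [AddCommGroup M] [Module A M] [AddCommGroup P] [Module A P]

theorem IsMonolith.eq_top_of_extension {S : Submodule A U} (hS : IsMonolith S) {φ : F →ₗ[A] U}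
    (hφ : Function.Surjective φ) {g : F →ₗ[A] S} (hg : ∀ x, φ x ∈ S → (g x : U) = φ x) :
    S = ⊤ := by
  have hker : ker φ ≤ ker g := fun x (hx : φ x = 0) =>
    Subtype.ext ((hg x (hx ▸ S.zero_mem)).trans hx)
  obtain ⟨ψ, hψ⟩ := exists_comp_eq_of_ker_le hφ hker
  have hretract : ψ ∘ₗ S.subtype = LinearMap.id := by
    ext ⟨u, hu⟩
    obtain ⟨x, rfl⟩ := hφ u
    exact (congrArg Subtype.val (LinearMap.congr_fun hψ x)).trans (hg x hu)
  have : Nontrivial S := S.nontrivial_iff_ne_bot.2 hS.ne_bot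
  have hcompl := isCompl_range_ker_of_comp_eq_id hretract
  rw [LinearMap.ker_eq_bot.2 (hS.bijective_of_comp_eq_id hretract).injective, S.range_subtype]
    at hcompl
  exact eq_top_of_isCompl_bot hcompl

theorem IsMonolith.projective_of_ker_le_ker [Nontrivial P] [Module.Projective A P]
    {S : Submodule A U} (hS : IsMonolith S) {φ : F →ₗ[A] U} (hφ : Function.Surjective φ)
    {g : F →ₗ[A] P} (hg : Function.Surjective g) (h : ker φ ≤ ker g) : Module.Projective A U := by
  obtain ⟨ψ, rfl⟩ := exists_comp_eq_of_ker_le hφ h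
  obtain ⟨s, hs⟩ := ψ.exists_rightInverse_of_surjective
    (LinearMap.range_eq_top.2 (Function.Surjective.of_comp hg))
  exact .of_equiv (LinearEquiv.ofBijective ψ (hS.bijective_of_comp_eq_id hs)).symm

theorem exists_monolithic_quotient_extending [IsSimpleModule A P] {L : Submodule A M}
    {f : L →ₗ[A] P} (hf : f ≠ 0) :
    ∃ (C : Submodule A M) (T : Submodule A (M ⧸ C)) (j : P →ₗ[A] M ⧸ C),
      IsMonolith T ∧ j ≠ 0 ∧ j ∘ₗ f = C.mkQ ∘ₗ L.subtype := by
  obtain ⟨x, hx⟩ : ∃ x, f x ≠ 0 := not_forall.1 fun h => hf (LinearMap.ext h)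
  have hxK : (x : M) ∉ (ker f).map L.subtype := by
    rintro ⟨y, hy, hyx⟩
    exact hx (L.injective_subtype hyx ▸ hy)
  obtain ⟨C, hKC, hC⟩ := exists_maximal_notMem hxK
  have hker : ker f ≤ ker (C.mkQ ∘ₗ L.subtype) := by
    rw [LinearMap.ker_comp, Submodule.ker_mkQ]
    exact Submodule.map_le_iff_le_comap.1 hKC
  obtain ⟨j, hj⟩ := exists_comp_eq_of_ker_le (LinearMap.surjective_of_ne_zero hf) hker
  refine ⟨C, _, j, isMonolith_span_mkQ hC, ?_, hj⟩
  rintro rfl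
  have hCx : C.mkQ x = 0 := (LinearMap.congr_fun hj x).symm
  exact hC.prop ((Submodule.Quotient.mk_eq_zero C).1 hCx)

theorem exists_idempotent_of_section {L : Submodule A M} {f : L →ₗ[A] P} {C : Submodule A M}
    {j : P →ₗ[A] M ⧸ C} (hj0 : j ≠ 0) (hj : j ∘ₗ f = C.mkQ ∘ₗ L.subtype) {s : M ⧸ C →ₗ[A] M}
    (hs : C.mkQ ∘ₗ s = LinearMap.id) :
    ∃ π : Module.End A M, IsIdempotentElem π ∧ π ≠ 0 ∧
      ∃ h : P →ₗ[A] range π, h ∘ₗ f = π.rangeRestrict ∘ₗ L.subtype := by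
  have hsq : ∀ y, C.mkQ (s y) = y := LinearMap.congr_fun hs
  have hrange : ∀ y, s y ∈ range (s ∘ₗ C.mkQ) := fun y => ⟨s y, congrArg s (hsq y)⟩
  refine ⟨s ∘ₗ C.mkQ, LinearMap.ext fun x => congrArg s (hsq _), fun h0 => hj0 ?_,
    (s ∘ₗ j).codRestrict _ fun y => hrange (j y), ?_⟩
  · have hs0 : ∀ y, s y = 0 := fun y =>
      (congrArg s (hsq y)).symm.trans (LinearMap.congr_fun h0 (s y))
    ext y
    rw [← hsq (j y), hs0, map_zero, LinearMap.zero_apply]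
  · ext y
    exact congrArg s (LinearMap.congr_fun hj y)

end

theorem HasProperMonolith.projective_of_forall_isAlmostInjective {U : Type u} [AddCommGroup U]
    [Module A U] (hU : HasProperMonolith A U)
    (h : ∀ (S : Type u) [AddCommGroup S] [Module A S], IsSimpleModule A S →
      IsAlmostInjective A S) : Module.Projective A U := by
  obtain ⟨S, hS, hStop⟩ := hU
  -- The two cases of almost injectivity of `S` are tested on a free module covering `U`.
  let φ : (U →₀ A) →ₗ[A] U := Finsupp.linearCombination A id
  have hφ : Function.Surjective φ := Finsupp.linearCombination_id_surjective A U
  let f : S.comap φ →ₗ[A] S := φ.restrict fun x hx => hx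
  rcases h S hS.isSimpleModule (U →₀ A) (S.comap φ) f with ⟨g, hg⟩ | ⟨π, hπ, hπ0, k, hk⟩
  · refine absurd (hS.eq_top_of_extension hφ (g := g) fun x hx => ?_) hStop
    exact (congrArg Subtype.val (LinearMap.congr_fun hg ⟨x, hx⟩)).symm
  · have := projective_range_of_isIdempotentElem hπ
    have : Nontrivial (range π) :=
      Submodule.nontrivial_iff_ne_bot.2 (LinearMap.range_eq_bot.not.2 hπ0)
    refine hS.projective_of_ker_le_ker (P := range π) (g := π.rangeRestrict) hφ
      (LinearMap.surjective_rangeRestrict π) fun x (hx : φ x = 0) => ?_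
    have hxS : φ x ∈ S := hx ▸ S.zero_mem
    have hfx : f ⟨x, hxS⟩ = 0 := Subtype.ext hx
    have hkx : k (f ⟨x, hxS⟩) = π.rangeRestrict x := LinearMap.congr_fun hk ⟨x, hxS⟩
    rw [LinearMap.mem_ker, ← hkx, hfx, map_zero]

theorem IsMonolithicProjective.isAlmostInjective (h : IsMonolithicProjective A) (S : Type u)
    [AddCommGroup S] [Module A S] [IsSimpleModule A S] : IsAlmostInjective A S := by
  intro N _ _ L f
  by_cases hf : f = 0
  · exact .inl ⟨0, hf⟩
  obtain ⟨C, T, j, hT, hj0, hj⟩ := exists_monolithic_quotient_extending hf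
  by_cases hTtop : T = ⊤
  · left
    have := hT.isSimpleModule_of_eq_top hTtop
    let e := LinearEquiv.ofBijective j (LinearMap.bijective_of_ne_zero hj0)
    refine ⟨e.symm ∘ₗ C.mkQ, LinearMap.ext fun y => ?_⟩
    exact (e.symm_apply_eq.2 (LinearMap.congr_fun hj y).symm).symm
  · right
    have := h _ ⟨T, hT, hTtop⟩
    obtain ⟨s, hs⟩ := C.mkQ.exists_rightInverse_of_surjective C.range_mkQ
    exact exists_idempotent_of_section hj0 hj hs

theorem isMonolithicProjective_iff_forall_isAlmostInjective :
    IsMonolithicProjective A ↔ ∀ (S : Type u) [AddCommGroup S] [Module A S],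
      IsSimpleModule A S → IsAlmostInjective A S :=
  ⟨fun h S _ _ _ => h.isAlmostInjective S,
    fun h _ _ _ hU => hU.projective_of_forall_isAlmostInjective h⟩

theorem IsMonolithicProjective.exists_isCoatom_or_isCompl (h : IsMonolithicProjective A)
    {M : Type u} [AddCommGroup M] [Module A M] {K : Submodule A M} {x : M} (hx : x ∉ K) :
    ∃ C, K ≤ C ∧ x ∉ C ∧ (IsCoatom C ∨
      ∃ D : Submodule A M, IsCompl D C ∧ Module.Projective A D ∧ HasProperMonolith A D) := by
  obtain ⟨C, hKC, hxC, hC⟩ := exists_isCoatom_or_hasProperMonolith hx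
  refine ⟨C, hKC, hxC, hC.imp_right fun hmono => ?_⟩
  have := h _ hmono
  obtain ⟨D, hD, hDproj⟩ := exists_isCompl_of_projective_quotient C
  exact ⟨D, hD, hDproj, hmono.congr (C.quotientEquivOfIsCompl D hD.symm)⟩

theorem isMonolithicProjective_iff_isVModule_or_exists_summand :
    IsMonolithicProjective A ↔ ∀ (M : Type u) [AddCommGroup M] [Module A M],
      IsVModule A M ∨ ∃ P : Submodule A M, P ≠ ⊥ ∧ (∃ Q : Submodule A M, IsCompl P Q) ∧
        Module.Projective A P := by
  constructor
  · intro h M _ _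
    rw [or_iff_not_imp_left, isVModule_iff]
    intro hM
    push Not at hM
    obtain ⟨K, x, hx, hK⟩ := hM
    obtain ⟨C, hKC, hxC, hC | ⟨D, hD, hDproj, hDmono⟩⟩ := h.exists_isCoatom_or_isCompl hx
    · exact absurd (hK C hC hKC) hxC
    · exact ⟨D, Submodule.nontrivial_iff_ne_bot.1 hDmono.nontrivial, ⟨C, hD⟩, hDproj⟩
  · rintro h U _ _ hU
    obtain hV | ⟨P, hP, ⟨Q, hPQ⟩, _⟩ := h U
    · exact absurd hV hU.not_isVModule
    · exact hU.choose_spec.1.projective_of_isCompl hP hPQ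

end AlmostInjective

section LengthTwo

/-- `M` is a local module of length two: its submodules are `0 < J(M) < M`, so that `J(M)` is both
the monolith and the largest proper submodule. -/
structure IsLocalOfLengthTwo (A M : Type*) [Ring A] [AddCommGroup M] [Module A M] : Prop where
  isMonolith : IsMonolith (Module.jacobson A M)
  isCoatom : IsCoatom (Module.jacobson A M)

section

variable {A M : Type*} [Ring A] [AddCommGroup M] [Module A M]

theorem IsMonolith.isLocalOfLengthTwo {S : Submodule A M} (hS : IsMonolith S)
    (hcoatom : IsCoatom S) : IsLocalOfLengthTwo A M := by
  have hJ : Module.jacobson A M = S := by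
    refine le_antisymm (sInf_le hcoatom) (le_sInf fun C hC => hS.le_of_ne_bot ?_)
    rintro rfl
    exact hcoatom.1 (hC.2 S hS.ne_bot.bot_lt)
  exact ⟨hJ.symm ▸ hS, hJ.symm ▸ hcoatom⟩

theorem length_eq_length_add_one_of_isCoatom {S : Submodule A M} (hS : IsCoatom S) :
    Module.length A M = Module.length A S + 1 := by
  have := isSimpleModule_iff_isCoatom.2 hS
  rw [Module.length_eq_add_of_exact S.subtype S.mkQ S.injective_subtype S.mkQ_surjective
    (LinearMap.exact_subtype_mkQ S), Module.length_eq_one A (M ⧸ S)]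

end

theorem isLocalOfLengthTwo_iff {A M : Type u} [Ring A] [AddCommGroup M] [Module A M] :
    IsLocalOfLengthTwo A M ↔ IsLocalModule A M ∧ Module.length A M = 2 := by
  constructor
  · intro h
    have := h.isMonolith.isSimpleModule
    refine ⟨⟨_, h.isCoatom.1, fun K hK => ?_⟩, ?_⟩
    · rcases eq_or_ne K ⊥ with rfl | hK0
      · exact bot_le
      · exact ((h.isCoatom.le_iff.1 (h.isMonolith.le_of_ne_bot hK0)).resolve_left hK).le
    · rw [length_eq_length_add_one_of_isCoatom h.isCoatom, Module.length_eq_one,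
        one_add_one_eq_two]
  · rintro ⟨⟨S, hStop, hS⟩, hlength⟩
    have hcoatom : IsCoatom S :=
      ⟨hStop, fun K hK => not_not.1 fun hKtop => hK.not_ge (hS K hKtop)⟩
    rw [length_eq_length_add_one_of_isCoatom hcoatom, ← one_add_one_eq_two] at hlength
    have hatom : IsAtom S := isSimpleModule_iff_isAtom.1 <| Module.length_eq_one_iff.1 <|
      ENat.add_left_injective_of_ne_top ENat.one_ne_top hlength
    have hmono : IsMonolith S := by
      refine ⟨hatom.1, fun {K} hK => ?_⟩
      rcases eq_or_ne K ⊤ with rfl | hKtop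
      · exact le_top
      · exact ((hatom.le_iff.1 (hS K hKtop)).resolve_left hK).ge
    exact hmono.isLocalOfLengthTwo hcoatom

end LengthTwo

section Structure

variable {A M : Type u} [Ring A] [AddCommGroup M] [Module A M] {S : Submodule A M}

theorem IsMonolith.bijective_of_injective (hS : IsMonolith S) {P : Type u} [AddCommGroup P]
    [Module A P] [Nontrivial P] [Module.Injective A P] {g : P →ₗ[A] M}
    (hg : Function.Injective g) : Function.Bijective g := by
  obtain ⟨r, hr⟩ := Module.Injective.out g hg LinearMap.id
  have hbij : Function.Bijective r := hS.bijective_of_comp_eq_id (LinearMap.ext hr)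
  exact ⟨hg, fun y => ⟨r y, hbij.injective (hr (r y))⟩⟩

theorem IsMonolith.eq_top_or_eq_top_of_sup_eq_top (hS : IsMonolith S) [Module.Projective A M]
    [Module.Injective A M] {K L : Submodule A M} (h : K ⊔ L = ⊤) : K = ⊤ ∨ L = ⊤ := by
  have : Nontrivial M := (Submodule.nontrivial_iff A).1 ⟨_, _, hS.ne_bot⟩
  obtain ⟨s, hs⟩ := (K.subtype.coprod L.subtype).exists_rightInverse_of_surjective
    (by simpa [LinearMap.range_coprod] using h)
  -- `ker a` and `ker b` are disjoint, so one of `a`, `b` is injective, hence bijective onto `M`.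
  let a : M →ₗ[A] K := LinearMap.fst A K L ∘ₗ s
  let b : M →ₗ[A] L := LinearMap.snd A K L ∘ₗ s
  have hab : ∀ y, (a y : M) + b y = y := LinearMap.congr_fun hs
  have hdisj : Disjoint (ker a) (ker b) := Submodule.disjoint_def.2 fun y ha hb => by
    rw [← hab y, LinearMap.mem_ker.1 ha, LinearMap.mem_ker.1 hb, K.coe_zero, L.coe_zero, add_zero]
  have eq_top : ∀ {N : Submodule A M} {c : M →ₗ[A] N}, ker c = ⊥ → N = ⊤ := fun {N c} hc => by
    have hinj : Function.Injective (N.subtype ∘ₗ c) :=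
      N.injective_subtype.comp (LinearMap.ker_eq_bot.1 hc)
    refine eq_top_iff.2 fun y _ => ?_
    obtain ⟨x, rfl⟩ := (hS.bijective_of_injective hinj).surjective y
    exact (c x).2
  by_cases ha : ker a = ⊥
  · exact .inl (eq_top ha)
  · exact .inr (eq_top (hS.eq_bot_of_disjoint hdisj ha))

theorem IsMonolith.exists_injective_mkQ_comp (hS : IsMonolith S) {Q : Type u} [AddCommGroup Q]
    [Module A Q] {i : M →ₗ[A] Q} (hi : Function.Injective i) :
    ∃ (C : Submodule A Q) (T : Submodule A (Q ⧸ C)),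
      IsMonolith T ∧ Function.Injective (C.mkQ ∘ₗ i) := by
  obtain ⟨x, hxS, hx0⟩ := Submodule.exists_mem_ne_zero_of_ne_bot hS.ne_bot
  have hix : i x ∉ (⊥ : Submodule A Q) := (map_ne_zero_iff i hi).2 hx0
  obtain ⟨C, -, hC⟩ := exists_maximal_notMem hix
  refine ⟨C, _, isMonolith_span_mkQ hC, LinearMap.ker_eq_bot.1 (not_not.1 fun hker => ?_)⟩
  have hx : C.mkQ (i x) = 0 := hS.le_of_ne_bot hker hxS
  exact hC.prop ((Submodule.Quotient.mk_eq_zero C).1 hx)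

namespace IsMonolithicProjective

theorem isCoatom_of_injective (h : IsMonolithicProjective A) [Module.Injective A M]
    (hS : IsMonolith S) (hStop : S ≠ ⊤) : IsCoatom S := by
  have := h M ⟨S, hS, hStop⟩
  have hcoatom : ∀ y ∉ S, ∃ C, IsCoatom C ∧ S ≤ C ∧ y ∉ C := by
    intro y hy
    obtain ⟨C, hSC, hyC, hC | ⟨D, hD, -, hDmono⟩⟩ := h.exists_isCoatom_or_isCompl hy
    · exact ⟨C, hC, hSC, hyC⟩
    · have hD0 : D = ⊥ :=
        hS.eq_bot_of_disjoint hD.disjoint.symm (ne_bot_of_le_ne_bot hS.ne_bot hSC)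
      exact absurd hD0 (Submodule.nontrivial_iff_ne_bot.1 hDmono.nontrivial)
  obtain ⟨y, -, hy⟩ := SetLike.exists_of_lt hStop.lt_top
  obtain ⟨C, hC, hSC, -⟩ := hcoatom y hy
  have hCS : C ≤ S := by
    intro z hzC
    by_contra hzS
    obtain ⟨C', hC', -, hzC'⟩ := hcoatom z hzS
    have hsup : C ⊔ C' = ⊤ := (hC.codisjoint_of_ne hC' (by rintro rfl; exact hzC' hzC)).eq_top
    exact (hS.eq_top_or_eq_top_of_sup_eq_top hsup).elim hC.1 hC'.1
  exact hSC.antisymm hCS ▸ hC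

theorem injective_quotient (h : IsMonolithicProjective A) [Module.Injective A M]
    {C : Submodule A M} (hC : HasProperMonolith A (M ⧸ C)) : Module.Injective A (M ⧸ C) := by
  have := h _ hC
  obtain ⟨s, hs⟩ := C.mkQ.exists_rightInverse_of_surjective C.range_mkQ
  exact injective_of_retract hs

theorem injective (h : IsMonolithicProjective A) (hM : HasProperMonolith A M) :
    Module.Injective A M := by
  have := hM.nontrivial
  obtain ⟨S, hS, hStop⟩ := hM
  obtain ⟨Q, _, _, i, _, hi⟩ := exists_injective_embedding A M
  obtain ⟨C, T, hT, hj⟩ := hS.exists_injective_mkQ_comp hi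
  set j : M →ₗ[A] Q ⧸ C := C.mkQ ∘ₗ i
  have hTj : T < range j := by
    refine (hT.le_of_ne_bot (range_ne_bot_of_injective hj)).lt_of_ne fun hTj => hStop ?_
    have := hT.isSimpleModule
    have : IsSimpleModule A M :=
      .congr ((LinearEquiv.ofInjective j hj).trans (LinearEquiv.ofEq _ _ hTj.symm))
    exact hS.eq_top_of_isSimpleModule
  have hTtop : T ≠ ⊤ := hTj.ne_top
  have := h.injective_quotient ⟨T, hT, hTtop⟩
  have hjtop : range j = ⊤ := (h.isCoatom_of_injective hT hTtop).2 _ hTj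
  exact injective_of_linearEquiv
    (LinearEquiv.ofBijective j ⟨hj, LinearMap.range_eq_top.1 hjtop⟩).symm

theorem isLocalOfLengthTwo (h : IsMonolithicProjective A) (hM : HasProperMonolith A M) :
    IsLocalOfLengthTwo A M := by
  have := h.injective hM
  obtain ⟨S, hS, hStop⟩ := hM
  exact hS.isLocalOfLengthTwo (h.isCoatom_of_injective hS hStop)

end IsMonolithicProjective

end Structure

section Radical

variable {A M : Type u} [Ring A] [AddCommGroup M] [Module A M] {P : Submodule A M}

theorem radicalOf_le (P : Submodule A M) : radicalOf P ≤ P :=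
  Submodule.map_subtype_le P _

theorem radicalOf_le_jacobson (P : Submodule A M) : radicalOf P ≤ Module.jacobson A M :=
  Module.map_jacobson_le P.subtype

namespace IsLocalOfLengthTwo

theorem radicalOf_ne_bot (hP : IsLocalOfLengthTwo A P) : radicalOf P ≠ ⊥ :=
  map_ne_bot_of_injective P.injective_subtype hP.isMonolith.ne_bot

theorem injective_domRestrict (hP : IsLocalOfLengthTwo A P) {N : Type*} [AddCommGroup N]
    [Module A N] {f : M →ₗ[A] N} (hf : ¬ radicalOf P ≤ ker f) :
    Function.Injective (f.domRestrict P) :=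
  LinearMap.ker_eq_bot.1 <| not_not.1 fun hker =>
    hf (Submodule.map_le_iff_le_comap.2 (hP.isMonolith.le_of_ne_bot hker))

theorem disjoint_of_disjoint_radicalOf (hP : IsLocalOfLengthTwo A P) {B : Submodule A M}
    (h : Disjoint (radicalOf P) B) : Disjoint P B := by
  rw [Submodule.disjoint_iff_comap_eq_bot]
  by_contra hPB
  exact hP.radicalOf_ne_bot <| h.eq_bot_of_le <|
    Submodule.map_le_iff_le_comap.2 (hP.isMonolith.le_of_ne_bot hPB)

end IsLocalOfLengthTwo

theorem IsMonolithicProjective.jacobson_eq_iSup_radicalOf (h : IsMonolithicProjective A)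
    {s : Set (Submodule A M)} (hs : sSupIndep s) (hloc : ∀ P ∈ s, IsLocalOfLengthTwo A P)
    (hmax : ∀ D : Submodule A M, HasProperMonolith A D → ¬ Disjoint D (sSup s)) :
    Module.jacobson A M = ⨆ P : s, radicalOf (P : Submodule A M) := by
  refine le_antisymm (fun x hx => ?_) (iSup_le fun P => radicalOf_le_jacobson _)
  by_contra hxJ
  obtain ⟨C, hJC, hxC, hC | ⟨D, hD, -, hDmono⟩⟩ := h.exists_isCoatom_or_isCompl hxJ
  · exact hxC (Submodule.mem_sInf.1 hx C hC)
  · have hindep : iSupIndep fun P : s => radicalOf (P : Submodule A M) :=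
      ((sSupIndep_iff s).1 hs).mono fun P => radicalOf_le _
    refine hmax D hDmono ?_
    rw [sSup_eq_iSup']
    exact disjoint_iSup_of_essential hindep
      (fun P B => (hloc P P.2).disjoint_of_disjoint_radicalOf) (hD.disjoint.mono_right hJC)

theorem IsMonolithicProjective.exists_isCoatom_of_jacobson_le (h : IsMonolithicProjective A)
    {K : Submodule A M} (hK : Module.jacobson A M ≤ K) {x : M} (hx : x ∉ K) :
    ∃ C, IsCoatom C ∧ K ≤ C ∧ x ∉ C := by
  obtain ⟨C, hKC, hxC, hC | ⟨D, hD, -, hDmono⟩⟩ := h.exists_isCoatom_or_isCompl hx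
  · exact ⟨C, hC, hKC, hxC⟩
  · refine absurd ?_ (h.isLocalOfLengthTwo hDmono).radicalOf_ne_bot
    exact le_bot_iff.1 <| hD.disjoint (radicalOf_le D) <|
      (radicalOf_le_jacobson D).trans (hK.trans hKC)

end Radical

section Opposite

variable {R : Type u} [Ring R]

/-- The right regular module `R` is the left regular module of `Rᵐᵒᵖ`. -/
def opSelfEquiv (R : Type u) [Ring R] : R ≃ₗ[Rᵐᵒᵖ] Rᵐᵒᵖ where
  toEquiv := MulOpposite.opEquiv
  map_add' _ _ := rfl
  map_smul' _ _ := rfl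

/-- The homomorphism `r ↦ u · r` of right modules, for `u` in a right module. -/
def rightSMulMap {U : Type*} [AddCommGroup U] [Module Rᵐᵒᵖ U] (u : U) : R →ₗ[Rᵐᵒᵖ] U :=
  LinearMap.toSpanSingleton Rᵐᵒᵖ U u ∘ₗ (opSelfEquiv R : R →ₗ[Rᵐᵒᵖ] Rᵐᵒᵖ)

theorem projective_principalRightIdeal {e : R} (he : IsIdempotentElem e) :
    Module.Projective Rᵐᵒᵖ (principalRightIdeal e) := by
  have : Module.Projective Rᵐᵒᵖ R := .of_equiv (opSelfEquiv R).symm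
  have hπ : IsIdempotentElem (LinearMap.mulLeft Rᵐᵒᵖ e) := LinearMap.ext fun r => by
    rw [Module.End.mul_apply, LinearMap.mulLeft_apply, LinearMap.mulLeft_apply, ← mul_assoc, he.eq]
  have hrange : range (LinearMap.mulLeft Rᵐᵒᵖ e) = principalRightIdeal e := by
    ext x
    simp only [LinearMap.mem_range, LinearMap.mulLeft_apply, mem_principalRightIdeal, eq_comm]
  exact hrange ▸ projective_range_of_isIdempotentElem hπ

theorem isUnit_one_sub_mul_comm {x y : R} : IsUnit (1 - x * y) ↔ IsUnit (1 - y * x) := by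
  simpa [spectrum.mem_iff, not_not] using
    (spectrum.unit_mem_mul_comm (R := ℤ) (a := x) (b := y) (r := 1)).not

theorem mem_ringJacobson_iff_isUnit {x : R} :
    x ∈ Ring.jacobson R ↔ ∀ r, IsUnit (1 - r * x) := by
  have left_inverse : ∀ y ∈ Ring.jacobson R, ∃ a, a * (1 - y) = 1 := by
    intro y hy
    rw [← Ideal.jacobson_bot, Ideal.mem_jacobson_iff] at hy
    obtain ⟨a, ha⟩ := hy (-1)
    exact ⟨a, by rw [← sub_eq_zero, ← Ideal.mem_bot.1 ha]; noncomm_ring⟩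
  constructor
  · intro hx r
    have hrx := Ideal.mul_mem_left _ r hx
    obtain ⟨a, ha⟩ := left_inverse _ hrx
    obtain ⟨b, hb⟩ := left_inverse _ (neg_mem (Ideal.mul_mem_left _ a hrx))
    have hba : b * a = 1 := by
      have hsub : 1 - -(a * (r * x)) = a := by
        rw [← ha]
        noncomm_ring
      rwa [hsub] at hb
    exact ⟨⟨1 - r * x, a, by rwa [← left_inv_eq_right_inv hba ha], ha⟩, rfl⟩
  · intro h
    rw [← Ideal.jacobson_bot, Ideal.mem_jacobson_iff]
    intro r
    obtain ⟨a, ha⟩ := (h (-r)).exists_left_inv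
    exact ⟨a, Ideal.mem_bot.2 (by rw [← ha]; noncomm_ring)⟩

theorem mem_jacobson_mulOpposite_iff {x : R} :
    x ∈ Module.jacobson Rᵐᵒᵖ R ↔ x ∈ Ring.jacobson R := by
  have hunit : ∀ r : R, IsUnit (1 - MulOpposite.op r * MulOpposite.op x) ↔ IsUnit (1 - r * x) :=
    fun r => (isUnit_op (m := 1 - x * r)).trans isUnit_one_sub_mul_comm
  rw [← Module.comap_jacobson_of_bijective (opSelfEquiv R).bijective, mem_ringJacobson_iff_isUnit]
  exact mem_ringJacobson_iff_isUnit.trans <|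
    MulOpposite.op_surjective.forall.trans (forall_congr' hunit)

theorem isRightVRing_quotient_iff (I : Ideal R) [I.IsTwoSided] :
    IsRightVRing (R ⧸ I) ↔ ∀ K : Submodule Rᵐᵒᵖ R, (I : Set R) ⊆ K →
      ∀ x ∉ K, ∃ C, IsCoatom C ∧ K ≤ C ∧ x ∉ C := by
  let τ : Rᵐᵒᵖ →+* (R ⧸ I)ᵐᵒᵖ := (Ideal.Quotient.mk I).op
  have : RingHomSurjective τ := ⟨fun y => by
    obtain ⟨x, hx⟩ := Ideal.Quotient.mk_surjective y.unop
    exact ⟨MulOpposite.op x, congrArg MulOpposite.op hx⟩⟩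
  let f : R →ₛₗ[τ] R ⧸ I :=
    { toFun := Ideal.Quotient.mk I
      map_add' := fun _ _ => rfl
      map_smul' := fun _ _ => rfl }
  have hker : (ker f : Set R) = I := Set.ext fun x => Ideal.Quotient.eq_zero_iff_mem
  rw [← hker]
  exact isVModule_iff_of_surjective (f := f) Ideal.Quotient.mk_surjective

theorem isRightVRing_quotient_jacobson_iff :
    IsRightVRing (R ⧸ Ring.jacobson R) ↔ ∀ K : Submodule Rᵐᵒᵖ R, Module.jacobson Rᵐᵒᵖ R ≤ K →
      ∀ x ∉ K, ∃ C, IsCoatom C ∧ K ≤ C ∧ x ∉ C := by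
  have hJ : (Ring.jacobson R : Set R) = Module.jacobson Rᵐᵒᵖ R :=
    Set.ext fun _ => mem_jacobson_mulOpposite_iff.symm
  rw [isRightVRing_quotient_iff, hJ]
  rfl

end Opposite

section OrthogonalIdempotents

variable {R : Type u} [Ring R]

theorem exists_orthogonalIdempotents_of_iSupIndep {ι : Type*} {P : ι → Submodule Rᵐᵒᵖ R}
    (hP : iSupIndep P) (hinj : ∀ i, Module.Injective Rᵐᵒᵖ (P i)) :
    ∃ e : ι → R, OrthogonalIdempotents e ∧ ∀ i, principalRightIdeal (e i) = P i := by
  choose q hqP hqker using fun i => exists_retraction_of_disjoint (hP i)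
  have hmul : ∀ i r, (q i 1 : R) * r = q i r := fun i r => by
    have hr := congrArg Subtype.val ((q i).map_smul (MulOpposite.op r) 1)
    rw [op_smul_eq_mul, one_mul] at hr
    exact hr.symm
  refine ⟨fun i => q i 1, ⟨fun i => ?_, fun i j hij => ?_⟩, fun i => ?_⟩
  · exact (hmul i _).trans (congrArg Subtype.val (hqP i (q i 1)))
  · have hle : P j ≤ ⨆ (k) (_ : k ≠ i), P k := le_iSup₂_of_le j hij.symm le_rfl
    have hker : (q j 1 : R) ∈ ker (q i) := hqker i (hle (q j 1).2)
    exact (hmul i _).trans (congrArg Subtype.val hker)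
  · ext x
    rw [mem_principalRightIdeal]
    refine ⟨?_, fun hx => ⟨x, ?_⟩⟩
    · rintro ⟨r, rfl⟩
      exact hmul i r ▸ (q i r).2
    · exact ((hmul i x).trans (congrArg Subtype.val (hqP i ⟨x, hx⟩))).symm

theorem IsMonolithicProjective.exists_orthogonalIdempotents (h : IsMonolithicProjective Rᵐᵒᵖ) :
    ∃ (I : Type u) (e : I → R), OrthogonalIdempotents e ∧
      (∀ i, IsLocalOfLengthTwo Rᵐᵒᵖ (principalRightIdeal (e i)) ∧
        Module.Injective Rᵐᵒᵖ (principalRightIdeal (e i))) ∧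
      iSupIndep (fun i => radicalOf (principalRightIdeal (e i))) ∧
      Module.jacobson Rᵐᵒᵖ R = ⨆ i, radicalOf (principalRightIdeal (e i)) := by
  obtain ⟨s, hs, hmono, hmax⟩ :=
    exists_maximal_sSupIndep fun P : Submodule Rᵐᵒᵖ R => HasProperMonolith Rᵐᵒᵖ P
  have hindep := (sSupIndep_iff s).1 hs
  have hloc : ∀ P ∈ s, IsLocalOfLengthTwo Rᵐᵒᵖ P := fun P hP => h.isLocalOfLengthTwo (hmono P hP)
  obtain ⟨e, he, heP⟩ := exists_orthogonalIdempotents_of_iSupIndep hindep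
    fun P => h.injective (hmono P P.2)
  refine ⟨s, e, he, fun P => ?_, ?_⟩
  · rw [heP]
    exact ⟨hloc P P.2, h.injective (hmono P P.2)⟩
  · simp only [heP]
    refine ⟨hindep.mono fun P => radicalOf_le _, h.jacobson_eq_iSup_radicalOf hs hloc
      fun D hD => ?_⟩
    exact hmax D (Submodule.nontrivial_iff_ne_bot.1 hD.nontrivial) hD

theorem HasProperMonolith.exists_not_jacobson_le_ker {U : Type u} [AddCommGroup U]
    [Module Rᵐᵒᵖ U] (hU : HasProperMonolith Rᵐᵒᵖ U) (hV : IsRightVRing (R ⧸ Ring.jacobson R)) :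
    ∃ u : U, ¬ Module.jacobson Rᵐᵒᵖ R ≤ ker (rightSMulMap u) := by
  obtain ⟨S, hS, hStop⟩ := hU
  obtain ⟨u, -, huS⟩ := SetLike.exists_of_lt hStop.lt_top
  -- If `u` were annihilated by `J(R)`, then `uR` would be a V-module; but `S` is proper in `uR`.
  refine ⟨u, fun hker => ?_⟩
  have hu : u ∈ range (rightSMulMap (R := R) u) := ⟨1, one_smul _ u⟩
  have hrange : range (rightSMulMap (R := R) u) ≠ ⊥ := by
    intro hbot
    rw [hbot, Submodule.mem_bot] at hu
    exact huS (hu ▸ S.zero_mem)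
  have hmono : HasProperMonolith Rᵐᵒᵖ (range (rightSMulMap (R := R) u)) :=
    ⟨_, hS.submoduleOf hrange, fun htop => huS (Submodule.submoduleOf_eq_top.1 htop hu)⟩
  refine hmono.not_isVModule ?_
  rw [isVModule_iff_of_surjective (LinearMap.surjective_rangeRestrict _),
    LinearMap.ker_rangeRestrict]
  exact fun K hK => isRightVRing_quotient_jacobson_iff.1 hV K (hker.trans hK)

theorem isMonolithicProjective_of_orthogonalIdempotents {I : Type*} {e : I → R}
    (he : ∀ i, IsIdempotentElem (e i))
    (hloc : ∀ i, IsLocalOfLengthTwo Rᵐᵒᵖ (principalRightIdeal (e i)))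
    (hinj : ∀ i, Module.Injective Rᵐᵒᵖ (principalRightIdeal (e i)))
    (hJ : Module.jacobson Rᵐᵒᵖ R = ⨆ i, radicalOf (principalRightIdeal (e i)))
    (hV : IsRightVRing (R ⧸ Ring.jacobson R)) : IsMonolithicProjective Rᵐᵒᵖ := by
  intro U _ _ hU
  obtain ⟨u, hu⟩ := hU.exists_not_jacobson_le_ker hV
  rw [hJ, iSup_le_iff, not_forall] at hu
  obtain ⟨i, hi⟩ := hu
  obtain ⟨S, hS, -⟩ := hU
  have : Nontrivial (principalRightIdeal (e i)) :=
    (Submodule.nontrivial_iff Rᵐᵒᵖ).1 ⟨_, _, (hloc i).isMonolith.ne_bot⟩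
  have := projective_principalRightIdeal (he i)
  exact .of_equiv (LinearEquiv.ofBijective _
    (hS.bijective_of_injective ((hloc i).injective_domRestrict hi)))

end OrthogonalIdempotents

theorem corollary2p1 (R : Type u) [Ring R] :
    List.TFAE [
      IsRightAlmostVRing R,
      ∀ (M : Type u) [AddCommGroup M] [Module Rᵐᵒᵖ M],
        IsVModule Rᵐᵒᵖ M ∨
          ∃ P : Submodule Rᵐᵒᵖ M, P ≠ ⊥ ∧ (∃ Q : Submodule Rᵐᵒᵖ M, IsCompl P Q) ∧
            Module.Projective Rᵐᵒᵖ P,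
      ∃ (I : Type u) (e : I → R), OrthogonalIdempotents e ∧
        (∀ i, IsLocalModule Rᵐᵒᵖ (principalRightIdeal (e i)) ∧
          Module.Injective Rᵐᵒᵖ (principalRightIdeal (e i)) ∧
          Module.length Rᵐᵒᵖ (principalRightIdeal (e i)) = 2) ∧
        (iSupIndep (fun i => radicalOf (principalRightIdeal (e i))) ∧
          Module.jacobson Rᵐᵒᵖ R = ⨆ i, radicalOf (principalRightIdeal (e i))) ∧
        IsRightVRing (R ⧸ Ring.jacobson R)] := by
  tfae_have 1 → 2 := fun h => isMonolithicProjective_iff_isVModule_or_exists_summand.1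
    (isMonolithicProjective_iff_forall_isAlmostInjective.2 h)
  tfae_have 2 → 3 := by
    intro h
    have hproj := isMonolithicProjective_iff_isVModule_or_exists_summand.2 h
    obtain ⟨I, e, he, hP, hindep, hJ⟩ := hproj.exists_orthogonalIdempotents
    refine ⟨I, e, he, fun i => ?_, ⟨hindep, hJ⟩, ?_⟩
    · obtain ⟨hlocal, hlength⟩ := isLocalOfLengthTwo_iff.1 (hP i).1
      exact ⟨hlocal, (hP i).2, hlength⟩
    · exact isRightVRing_quotient_jacobson_iff.2
        fun K hK x hx => hproj.exists_isCoatom_of_jacobson_le hK hx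
  tfae_have 3 → 1 := by
    rintro ⟨I, e, he, hP, ⟨-, hJ⟩, hV⟩
    refine isMonolithicProjective_iff_forall_isAlmostInjective.1 ?_
    exact isMonolithicProjective_of_orthogonalIdempotents he.idem
      (fun i => isLocalOfLengthTwo_iff.2 ⟨(hP i).1, (hP i).2.2⟩) (fun i => (hP i).2.1) hJ hV
  tfae_finish
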